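/- Let $\mathcal X\subset\mathbb R^n$ be compact and let $\mathcal H$ be a real reproducing kernel Hilbert space of functions on $\mathcal X$ whose reproducing kernel $K$ is locally Lipschitz on $\mathcal X\times\mathcal X$. Write $K_x=K(x,\cdot)$ and $\kappa=\bigl(\sup_{x\in\mathcal X}K(x,x)\bigr)^{1/2}$. Let $\mu$ be a Borel probability measure on $\mathcal X$ and let $x_1,x_2,\dots$ be i.i.d. random points of $\mathcal X$ with law $\mu$. Define the gramians on $\mathcal H$ $$W_c=\int_{\mathcal X}\langle\cdot,K_y\rangle K_y\,d\mu(y),\qquad W_{c,m}=\frac1m\sum_{i=1}^m\langle\cdot,K_{x_i}\rangle K_{x_i}\quad(m\ge 1),$$ and, for $\lambda>0$ and $x\in\mathcal X$, the regularized energies $$L_c^\lambda(x)=\tfrac12\bigl\langle(W_c+\lambda I)^{-2}W_cK_x,K_x\bigr\rangle,\qquad L_{c,m}^\lambda(x)=\tfrac12\bigl\langle(W_{c,m}+\lambda I)^{-2}W_{c,m}K_x,K_x\bigr\rangle .$$ Let $W_c^\dagger$ be the (in general unbounded) Moore–Penrose pseudoinverse of $W_c$, so that $W_c^\dagger W_c$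 is the orthogonal projection onto the closure of the range of $W_c$. Whenever $W_c^\dagger W_cK_x$ lies in the domain of $W_c^\dagger$, put $$L_c(x)=\tfrac12\bigl\langle W_c^\dagger(W_c^\dagger W_c)K_x,K_x\bigr\rangle .$$ Consider the condition $$W_c^\dagger W_cK_x\in\operatorname{dom}(W_c^\dagger)\ \text{ for all }x\in\mathcal X,\qquad \sup_{x\in\mathcal X}\bigl\|W_c^\dagger(W_c^\dagger W_c)K_x\bigr\|_{\mathcal H}<\infty.\tag{$*$}$$ (i) (Sample error.) For every $\lambda>0$, $x\in\mathcal X$, $m\ge1$ and $\delta\in(0,1]$, with probability at least $1-\delta$, $$\bigl|L_{c,m}^\lambda(x)-L_c^\lambda(x)\bigr|\le\frac{2\sqrt2\,\kappa^4(\lambda^2+\kappa^4)}{\lambda^4\sqrt m}\,\log^{1/2}\frac2\delta .$$ (ii) (Approximation error.) If $(*)$ holds, then for all $x\in\mathcal X$, $\lim_{\lambda\to0^+}\bigl|L_c^\lambda(x)-L_c(x)\bigr|=0$. (iii) (Consistency.) If $(*)$ holds and $(\lambda_m)_{m\ge1}$ is a sequence of positive numbers with $\lim_{m\to\infty}\lambda_m=0$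 and $\lim_{m\to\infty}\frac{\log^{1/2}m}{\lambda_m\sqrt m}=0$, then almost surely, for all $x\in\mathcal X$, $$\lim_{m\to\infty}\bigl|L_{c,m}^{\lambda_m}(x)-L_c(x)\bigr|=0 .$$ -/

import Mathlib

open MeasureTheory ProbabilityTheory Filter Topology

noncomputable section

/-! ### The Moore–Penrose pseudoinverse of a bounded operator on a Hilbert space -/

section Pseudoinverse

variable {H : Type*} [NormedAddCommGroup H] [InnerProductSpace ℝ H] [CompleteSpace H]

theorem exists_pinv (T : H →L[ℝ] H) (f : H) (hf : f ∈ T.range ⊔ (T.range)ᗮ) :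
    ∃ g : H, g ∈ (T.ker)ᗮ ∧ f - T g ∈ (T.range)ᗮ := by
  obtain ⟨_, ⟨u, rfl⟩, r, hr, rfl⟩ := Submodule.mem_sup.1 hf
  have : CompleteSpace T.ker := (ContinuousLinearMap.isClosed_ker T).completeSpace_coe
  obtain ⟨k, hk, g, hg, rfl⟩ := (T.ker).exists_add_mem_mem_orthogonal u
  refine ⟨g, hg, ?_⟩
  have hk' : T k = 0 := hk
  simpa [hk'] using hr

theorem pinv_unique (T : H →L[ℝ] H) (f g g' : H)
    (hg : g ∈ (T.ker)ᗮ) (hg' : g' ∈ (T.ker)ᗮ)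
    (h : f - T g ∈ (T.range)ᗮ) (h' : f - T g' ∈ (T.range)ᗮ) : g = g' := by
  have h1 : T (g - g') ∈ (T.range)ᗮ := by
    have := Submodule.sub_mem _ h' h
    simpa using this
  have h2 : T (g - g') = 0 :=
    inner_self_eq_zero.1 (Submodule.inner_right_of_mem_orthogonal (𝕜 := ℝ)
      (LinearMap.mem_range_self (T : H →ₗ[ℝ] H) (g - g')) h1)
  have h3 : g - g' ∈ (T.ker)ᗮ := Submodule.sub_mem _ hg hg'
  have h4 : g - g' = 0 :=
    inner_self_eq_zero.1 (Submodule.inner_right_of_mem_orthogonal (𝕜 := ℝ)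
      (show g - g' ∈ T.ker from h2) h3)
  exact sub_eq_zero.1 h4

/-- The Moore–Penrose pseudoinverse `T†` of a bounded operator `T`, as a partially defined linear
operator with domain `range T ⊕ (range T)ᗮ`. For `f` in the domain, `T† f` is the unique
`g ∈ (ker T)ᗮ` such that `T g` is the `range T` component of `f`; in particular `T†` inverts
`T` restricted to `(ker T)ᗮ` on `range T` and vanishes on `(range T)ᗮ`. -/
def pinv (T : H →L[ℝ] H) : H →ₗ.[ℝ] H where
  domain := T.range ⊔ (T.range)ᗮ
  toFun :=
    { toFun := fun f => (exists_pinv T f f.2).choose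
      map_add' := fun a b => by
        have ha := (exists_pinv T a a.2).choose_spec
        have hb := (exists_pinv T b b.2).choose_spec
        have hab := (exists_pinv T (a + b : H) (Submodule.add_mem _ a.2 b.2)).choose_spec
        refine pinv_unique T (a + b : H) _ _ hab.1 (Submodule.add_mem _ ha.1 hb.1) hab.2 ?_
        have := Submodule.add_mem _ ha.2 hb.2
        rw [map_add]
        convert this using 1
        abel
      map_smul' := fun c a => by
        have ha := (exists_pinv T a a.2).choose_spec
        have hca := (exists_pinv T (c • a : H) (Submodule.smul_mem _ c a.2)).choose_spec
        refine pinv_unique T (c • a : H) _ _ hca.1 (Submodule.smul_mem _ c ha.1) hca.2 ?_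
        have := Submodule.smul_mem _ c ha.2
        simpa [smul_sub] using this }

theorem pinv_spec (T : H →L[ℝ] H) (f : (pinv T).domain) :
    pinv T f ∈ (T.ker)ᗮ ∧ (f : H) - T (pinv T f) ∈ (T.range)ᗮ :=
  (exists_pinv T f f.2).choose_spec

theorem apply_mem_pinv_domain (T : H →L[ℝ] H) (h : H) : T h ∈ (pinv T).domain :=
  Submodule.mem_sup_left (LinearMap.mem_range_self (T : H →ₗ[ℝ] H) h)

/-- The composition `T† T`, which is defined on the whole space. -/
def pinvComp (T : H →L[ℝ] H) (h : H) : H :=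
  pinv T ⟨T h, apply_mem_pinv_domain T h⟩

/-- `h` lies in the domain of `T† (T† T)`. -/
def InPinvDomain (T : H →L[ℝ] H) (h : H) : Prop :=
  pinvComp T h ∈ (pinv T).domain

/-- The vector `T† (T† T) h`, for `h` in the domain of `T† (T† T)`. -/
def pinvProj (T : H →L[ℝ] H) (h : H) (hh : InPinvDomain T h) : H :=
  pinv T ⟨pinvComp T h, hh⟩

/-- The pseudoinverse energy `½ ⟪T† (T† T) h, h⟫`. -/
def pinvEnergy (T : H →L[ℝ] H) (h : H) (hh : InPinvDomain T h) : ℝ :=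
  1 / 2 * inner ℝ (pinvProj T h hh) h

/-- The regularized energy `½ ⟪(T + r I)⁻² T h, h⟫`. For `T` positive and `r > 0` the operator
`T + r I` is invertible (`isUnit_add_smul_one`), so that `Ring.inverse` is its inverse. -/
def regEnergy (T : H →L[ℝ] H) (r : ℝ) (h : H) : ℝ :=
  1 / 2 * inner ℝ ((Ring.inverse (T + r • 1) ^ 2 * T) h) h

theorem isUnit_add_smul_one (T : H →L[ℝ] H) (hT : T.IsPositive) {r : ℝ} (hr : 0 < r) :
    IsUnit (T + r • 1) := by
  refine ContinuousLinearMap.isUnit_of_forall_le_norm_inner_map _ (c := r.toNNReal) (by simpa using hr) fun x => ?_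
  have h1 : 0 ≤ inner ℝ (T x) x := hT.inner_nonneg_left x
  have h2 : inner ℝ ((T + r • (1 : H →L[ℝ] H)) x) x = inner ℝ (T x) x + r * ‖x‖ ^ 2 := by
    simp [inner_add_left, inner_smul_left]
  rw [h2, Real.norm_of_nonneg (by positivity)]
  rw [Real.coe_toNNReal r hr.le]
  linarith

end Pseudoinverse

/-! ### Gramians in a reproducing kernel Hilbert space -/

section Gramian

variable {X : Type*} (H : Type*) [NormedAddCommGroup H] [InnerProductSpace ℝ H] [CompleteSpace H]
  [RKHS ℝ H X ℝ]

/-- The feature vector `K_x = K(x, ·) ∈ H`, characterised by `f x = ⟪f, K_x⟫`. -/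
def feat (x : X) : H := RKHS.kerFun H x 1

/-- The (scalar) reproducing kernel `K(x, y)` of `H`. -/
def kerR (x y : X) : ℝ := RKHS.kernel H x y 1

theorem inner_feat (x y : X) : inner ℝ (feat H x) (feat H y) = kerR H x y := by
  simp only [feat, kerR, RKHS.kerFun_inner, RKHS.kerFun_apply]
  simp

/-- `κ`, where `κ² = sup_x K(x, x)`. -/
def kappa : ℝ := Real.sqrt (⨆ x : X, kerR H x x)

/-- The gramian `W_c = ∫ ⟪·, K_x⟫ K_x dμ(x)`. -/
def gramian [MeasurableSpace X] (μ : Measure X) : H →L[ℝ] H :=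
  ∫ x, InnerProductSpace.rankOne ℝ (feat H x) (feat H x) ∂μ

theorem continuous_feat [TopologicalSpace X]
    (hK : Continuous fun p : X × X => kerR H p.1 p.2) : Continuous (feat H : X → H) := by
  rw [continuous_iff_continuousAt]
  intro x
  have h1 : Continuous fun y : X => Real.sqrt (kerR H y y - 2 * kerR H y x + kerR H x x) := by
    have a : Continuous fun y : X => kerR H y y := 
      Continuous.comp (g := fun p : X × X => kerR H p.1 p.2) (f := fun y : X => (y, y)) hK
        (by fun_prop)
    have b : Continuous fun y : X => kerR H y x := 
      Continuous.comp (g := fun p : X × X => kerR H p.1 p.2) (f := fun y : X => (y, x)) hK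
        (by fun_prop)
    exact ((a.sub (b.const_mul 2)).add continuous_const).sqrt
  have h2 : ∀ y : X, ‖feat H y - feat H x‖
      = Real.sqrt (kerR H y y - 2 * kerR H y x + kerR H x x) := by
    intro y
    have h := norm_sub_sq_real (feat H y) (feat H x)
    rw [← real_inner_self_eq_norm_sq (feat H y), ← real_inner_self_eq_norm_sq (feat H x),
      inner_feat, inner_feat, inner_feat] at h
    rw [← h, Real.sqrt_sq (norm_nonneg _)]
  refine tendsto_iff_norm_sub_tendsto_zero.2 ?_
  have h3 := h1.tendsto x
  have h4 : kerR H x x - 2 * kerR H x x + kerR H x x = 0 := by ring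
  rw [h4, Real.sqrt_zero] at h3
  exact h3.congr fun y => (h2 y).symm

/-- The integral defining `gramian` converges when `X` is compact and the kernel continuous. -/
theorem integrable_gramian [TopologicalSpace X] [CompactSpace X] [MeasurableSpace X]
    [OpensMeasurableSpace X] (μ : Measure X) [IsFiniteMeasure μ]
    (hK : Continuous fun p : X × X => kerR H p.1 p.2) :
    Integrable (fun x => InnerProductSpace.rankOne ℝ (feat H x) (feat H x)) μ := by
  have h := continuous_feat H hK
  have hc : Continuous fun x : X => InnerProductSpace.rankOne ℝ (feat H x) (feat H x) := by
    simp only [InnerProductSpace.rankOne_def]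
    fun_prop
  exact hc.integrable_of_hasCompactSupport (HasCompactSupport.of_compactSpace _)

/-- The empirical gramian `W_{c,m} = (1/m) ∑_{i < m} ⟪·, K_{x_i}⟫ K_{x_i}`. -/
def empGramian {m : ℕ} (s : Fin m → X) : H →L[ℝ] H :=
  (m : ℝ)⁻¹ • ∑ i, InnerProductSpace.rankOne ℝ (feat H (s i)) (feat H (s i))

/-- The regularized energy `L_c^r(x) = ½ ⟪(W_c + r I)⁻² W_c K_x, K_x⟫`. -/
def energy [MeasurableSpace X] (μ : Measure X) (r : ℝ) (x : X) : ℝ :=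
  regEnergy (gramian H μ) r (feat H x)

/-- The kernel controllability energy
`L_{c,m}^r(x) = ½ ⟪(W_{c,m} + r I)⁻² W_{c,m} K_x, K_x⟫` of the sample `s`;
`empEnergy_eq` gives its expression through the kernel matrix. -/
def empEnergy {m : ℕ} (s : Fin m → X) (r : ℝ) (x : X) : ℝ :=
  regEnergy (empGramian H s) r (feat H x)

theorem empGramian_isPositive {m : ℕ} (s : Fin m → X) : (empGramian H s).IsPositive := by
  unfold empGramian
  refine ContinuousLinearMap.IsPositive.smul_of_nonneg ?_ (by positivity)
  exact Finset.sum_induction _ ContinuousLinearMap.IsPositive (fun _ _ => .add)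
    ContinuousLinearMap.isPositive_zero
    fun i _ => InnerProductSpace.isPositive_rankOne_self (feat H (s i))

/-- The kernel matrix `(K(x_i, x_j))_{i,j}`. -/
def kerMatrix {m : ℕ} (s : Fin m → X) : Matrix (Fin m) (Fin m) ℝ :=
  Matrix.of fun i j => kerR H (s i) (s j)

theorem kerMatrix_posSemidef {m : ℕ} (s : Fin m → X) : (kerMatrix H s).PosSemidef := by
  have : kerMatrix H s = Matrix.gram ℝ (fun i => feat H (s i)) := by
    ext i j
    simp [kerMatrix, Matrix.gram, inner_feat]
  rw [this]
  exact Matrix.posSemidef_gram ℝ _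

open Matrix in
/-- `L_{c,m}^r(x) = (1/2m) k(x)ᵀ ((1/m) K + r I)⁻² k(x)` with `k(x)_i = K(x, x_i)`. -/
theorem empEnergy_eq {m : ℕ} (s : Fin m → X) {r : ℝ} (hr : 0 < r) (x : X) :
    empEnergy H s r x = 1 / (2 * m) *
      ((fun i => kerR H x (s i)) ⬝ᵥ
        ((((m : ℝ)⁻¹ • kerMatrix H s + r • (1 : Matrix (Fin m) (Fin m) ℝ))⁻¹ ^ 2) *ᵥ
          (fun i => kerR H x (s i)))) := by
  set k : Fin m → ℝ := fun i => kerR H x (s i) with hk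
  set M := (m : ℝ)⁻¹ • kerMatrix H s + r • (1 : Matrix (Fin m) (Fin m) ℝ) with hM
  set A := empGramian H s + r • (1 : H →L[ℝ] H) with hA
  set U : (Fin m → ℝ) → H := fun v => ∑ i, v i • feat H (s i) with hU
  have hMu : IsUnit M := by
    have h0 : ((m : ℝ)⁻¹ • kerMatrix H s).PosSemidef :=
      (kerMatrix_posSemidef H s).smul (by positivity)
    have h1 : (r • (1 : Matrix (Fin m) (Fin m) ℝ)).PosDef := Matrix.PosDef.one.smul hr
    exact (Matrix.PosDef.posSemidef_add h0 h1).isUnit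
  have hAu : IsUnit A := isUnit_add_smul_one _ (empGramian_isPositive H s) hr
  have hAU : ∀ v, A (U v) = U (M *ᵥ v) := by
    intro v
    have h1 : empGramian H s (U v) = U (((m : ℝ)⁻¹ • kerMatrix H s) *ᵥ v) := by
      simp only [hU, empGramian, FunLike.coe_smul, Pi.smul_apply, _root_.sum_apply,
        InnerProductSpace.rankOne_apply, inner_sum, inner_smul_right, inner_feat,
        Matrix.smul_mulVec, Matrix.mulVec, dotProduct, kerMatrix, Matrix.of_apply, Finset.smul_sum,
        smul_smul, smul_eq_mul]
      refine Finset.sum_congr rfl fun i _ => ?_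
      congr 2
      exact Finset.sum_congr rfl fun j _ => mul_comm _ _
    have h2 : U ((r • (1 : Matrix (Fin m) (Fin m) ℝ)) *ᵥ v) = r • U v := by
      simp [hU, Matrix.smul_mulVec, Finset.smul_sum, smul_smul]
    have h3 : ∀ a b, U (a + b) = U a + U b := by
      intro a b
      simp [hU, add_smul, Finset.sum_add_distrib]
    rw [hM, Matrix.add_mulVec, h3, h2, ← h1]
    simp [hA]
  have hW : empGramian H s (feat H x) = (m : ℝ)⁻¹ • U k := by
    have hsymm : ∀ i, inner ℝ (feat H (s i)) (feat H x) = kerR H x (s i) := by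
      intro i
      rw [real_inner_comm, inner_feat]
    simp [empGramian, hU, hk, hsymm]
  have hinv : ∀ v, Ring.inverse A (U v) = U (M⁻¹ *ᵥ v) := by
    intro v
    have h1 : v = M *ᵥ (M⁻¹ *ᵥ v) := by
      rw [Matrix.mulVec_mulVec, Matrix.mul_nonsing_inv _ ((Matrix.isUnit_iff_isUnit_det _).1 hMu),
        Matrix.one_mulVec]
    conv_lhs => rw [h1, ← hAU]
    rw [← mul_apply_eq_comp, Ring.inverse_mul_cancel _ hAu]
    simp
  have h5 : (Ring.inverse A ^ 2 * empGramian H s) (feat H x)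
      = (m : ℝ)⁻¹ • U ((M⁻¹ ^ 2) *ᵥ k) := by
    rw [mul_apply_eq_comp, hW, map_smul, pow_two, mul_apply_eq_comp, hinv,
      hinv, Matrix.mulVec_mulVec, pow_two]
  have h6 : ∀ v, inner ℝ (U v) (feat H x) = k ⬝ᵥ v := by
    intro v
    simp only [hU, sum_inner, inner_smul_left, dotProduct]
    refine Finset.sum_congr rfl fun i _ => ?_
    rw [real_inner_comm, inner_feat]
    simp [hk, mul_comm]
  unfold empEnergy regEnergy
  rw [← hA, h5, inner_smul_left, h6]
  simp
  ring

end Gramian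

end

noncomputable section

/-! ### A Hoeffding inequality in Hilbert space, by way of the hyperbolic cosine of the norm. -/

section Concentration

/-! Write `W` and `W_m` for the true and empirical gramians. Everything rests on the size of `‖W_m -
W‖` and on two perturbation bounds for the filter `(T + r)⁻² T`.

The operator `W_m - W` corresponds to the mean of the centred vectors `K_x ⊗ K_x` in the completed
tensor square of `H`, a Hilbert space whose norm dominates the operator norm. For a centred vector
`Φ` bounded by `c`, the expectation of `cosh ‖s + Φ‖` is at most `exp (c²) cosh ‖s‖`. Independence
iterates this bound, and Markov's inequality gives `‖W_m - W‖ = O(√(L / m))` outside an event of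
probability `2 exp (-L)` (`measure_norm_empGramian_sub_ge_le`).

The identity `regInv_sq_sub` isolates one factor `A - B` in the difference of two filters. Bounding
the resolvents by `1 / r` gives the sample error (`abs_regEnergy_sub_le`).

Under the domain condition, `K_x = W g + n` with `n ∈ ker W` and `g ∈ (ker W)ᗮ`. Then `(W + r)⁻² W
K_x = (W (W + r)⁻¹)² g`, which tends to `g`: this is the approximation error.

For consistency, the `r⁻⁴` of the sample error is too weak. On `W g` the factor `W` absorbs
resolvents and only `1 / r` is lost (`abs_regEnergy_sub_apply_le`). The component `n` contributes
nothing, because almost surely `W_m` kills `ker W`. Borel–Cantelli gives `‖W_m - W‖ = O(√(log m /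
m))` almost surely, hence the rate condition. -/

theorem exp_sub_self_le_exp_sq {v : ℝ} (hv : 0 ≤ v) : Real.exp v - v ≤ Real.exp (v ^ 2) := by
  rcases le_total v 1 with h | h
  -- For `v ≤ 1`, Taylor's formula gives `exp v - v ≤ 1 + v²/2 + (2/9) v³ ≤ 1 + v²`.
  · have h1 := Real.exp_bound' hv h (n := 3) (by norm_num)
    have h2 := Real.add_one_le_exp (v ^ 2)
    norm_num [Finset.sum_range_succ, Nat.factorial] at h1
    nlinarith [mul_nonneg (sq_nonneg v) (sub_nonneg.2 h)]
  · have : Real.exp v ≤ Real.exp (v ^ 2) := Real.exp_le_exp.2 (by nlinarith)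
    linarith

/-- The power series `∑ wⁿ / (2n)!` has nonnegative coefficients, and each `wⁿ` is convex on `[0,
∞)`. -/
theorem convexOn_cosh_sqrt : ConvexOn ℝ (Set.Ici 0) fun w : ℝ => Real.cosh √w := by
  have hs : ∀ w : ℝ, 0 ≤ w →
      HasSum (fun n : ℕ => w ^ n / ((2 * n).factorial : ℝ)) (Real.cosh √w) := by
    intro w hw
    have := Real.hasSum_cosh √w
    simpa only [pow_mul, Real.sq_sqrt hw] using this
  refine ⟨convex_Ici 0, fun x hx y hy a b ha hb hab => ?_⟩
  have hxy : (0 : ℝ) ≤ a • x + b • y := by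
    have : (0 : ℝ) ≤ x := hx
    have : (0 : ℝ) ≤ y := hy
    simp only [smul_eq_mul]; positivity
  refine hasSum_le (fun n => ?_) (hs _ hxy)
    (((hs x hx).const_smul a).add ((hs y hy).const_smul b))
  have h := (convexOn_pow (𝕜 := ℝ) n).2 hx hy ha hb hab
  have h2 : (0 : ℝ) < ((2 * n).factorial : ℝ) := by positivity
  simp only [smul_eq_mul] at h ⊢
  rw [← mul_div_assoc, ← mul_div_assoc, ← add_div]
  gcongr

/-- With `u = ‖s‖`, `v = ‖x‖` and `p = ⟪s, x⟫`, the argument of the root is `‖s + x‖²`. It is affine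
in `p` and lies between `(u - v)²` and `(u + v)²`, so convexity bounds the left side by the chord.
-/
theorem cosh_sqrt_le_chord {u v p : ℝ} (hu : 0 < u) (hv : 0 < v) (hp : |p| ≤ u * v) :
    Real.cosh √(u ^ 2 + 2 * p + v ^ 2) ≤
      Real.cosh u * Real.cosh v + p / (u * v) * (Real.sinh u * Real.sinh v) := by
  have huv : 0 < u * v := mul_pos hu hv
  obtain ⟨h1, h2⟩ := abs_le.1 hp
  set a := (1 + p / (u * v)) / 2 with ha
  set b := (1 - p / (u * v)) / 2 with hb
  have e1 : p / (u * v) ≤ 1 := (div_le_one huv).2 h2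
  have e2 : -1 ≤ p / (u * v) := by rw [le_div_iff₀ huv]; linarith
  have h := convexOn_cosh_sqrt.2 (Set.mem_Ici.2 (sq_nonneg (u + v)))
    (Set.mem_Ici.2 (sq_nonneg (u - v)))
    (show 0 ≤ a by rw [ha]; linarith) (show 0 ≤ b by rw [hb]; linarith) (by rw [ha, hb]; ring)
  have e3 : a • (u + v) ^ 2 + b • (u - v) ^ 2 = u ^ 2 + 2 * p + v ^ 2 := by
    simp only [smul_eq_mul, ha, hb]
    field_simp
    ring
  rw [e3] at h
  simp only [Real.sqrt_sq_eq_abs, Real.cosh_abs, Real.cosh_add, Real.cosh_sub, smul_eq_mul] at h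
  refine h.trans (le_of_eq ?_)
  rw [ha, hb]
  ring

variable {E : Type*} [NormedAddCommGroup E] [InnerProductSpace ℝ E]

/-- The hyperbolic cosine of the norm is dominated by an affine function of the increment. -/
theorem cosh_norm_add_le (s x : E) :
    Real.cosh ‖s + x‖ ≤ Real.cosh ‖s‖ * Real.exp (‖x‖ ^ 2) +
      Real.sinh ‖s‖ / ‖s‖ * inner ℝ s x := by
  rcases eq_or_ne s 0 with rfl | hs
  · have h := exp_sub_self_le_exp_sq (norm_nonneg x)
    have h2 : Real.sinh ‖x‖ ≥ ‖x‖ := Real.self_le_sinh_iff.2 (norm_nonneg x)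
    have h3 := Real.cosh_add_sinh ‖x‖
    simp
    linarith
  rcases eq_or_ne x 0 with rfl | hx
  · simp
  have hs' : 0 < ‖s‖ := norm_pos_iff.2 hs
  have hx' : 0 < ‖x‖ := norm_pos_iff.2 hx
  have hp := abs_real_inner_le_norm s x
  have h := cosh_sqrt_le_chord hs' hx' hp
  rw [← norm_add_sq_real, Real.sqrt_sq (norm_nonneg _)] at h
  refine h.trans ?_
  have h2 : ‖x‖ ≤ Real.sinh ‖x‖ := Real.self_le_sinh_iff.2 hx'.le
  have h3 := Real.cosh_add_sinh ‖x‖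
  have h4 := exp_sub_self_le_exp_sq hx'.le
  have h5 : 0 ≤ Real.sinh ‖s‖ := Real.sinh_nonneg_iff.2 hs'.le
  have h6 : Real.sinh ‖s‖ ≤ Real.cosh ‖s‖ := (Real.sinh_lt_cosh _).le
  have h7 : inner ℝ s x / (‖s‖ * ‖x‖) ≤ 1 :=
    (div_le_one (by positivity)).2 ((le_abs_self _).trans hp)
  -- Split `sinh ‖x‖` as `(sinh ‖x‖ - ‖x‖) + ‖x‖`. The second part leaves a term linear in `x`,
  -- which a centred law integrates to zero; in the first, the cosine of the angle is bounded by
  -- `1`.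
  have e : inner ℝ s x / (‖s‖ * ‖x‖) * (Real.sinh ‖s‖ * Real.sinh ‖x‖) =
      inner ℝ s x / (‖s‖ * ‖x‖) * (Real.sinh ‖s‖ * (Real.sinh ‖x‖ - ‖x‖)) +
      Real.sinh ‖s‖ / ‖s‖ * inner ℝ s x := by
    field_simp
    ring
  have h8 : inner ℝ s x / (‖s‖ * ‖x‖) * (Real.sinh ‖s‖ * (Real.sinh ‖x‖ - ‖x‖)) ≤
      1 * (Real.cosh ‖s‖ * (Real.sinh ‖x‖ - ‖x‖)) := by
    have : 0 ≤ Real.sinh ‖x‖ - ‖x‖ := by linarith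
    gcongr
  have h9 : Real.cosh ‖s‖ * (Real.exp ‖x‖ - ‖x‖) ≤ Real.cosh ‖s‖ * Real.exp (‖x‖ ^ 2) := by
    have := (Real.cosh_pos ‖s‖).le
    gcongr
  rw [← h3] at h9
  rw [e]
  linarith

variable [CompleteSpace E] {X : Type*} [MeasurableSpace X]

theorem lintegral_cosh_norm_add_le (μ : Measure X) [IsProbabilityMeasure μ] {Φ : X → E}
    (hΦ : StronglyMeasurable Φ) {c : ℝ} (hc : ∀ x, ‖Φ x‖ ≤ c) (h0 : ∫ x, Φ x ∂μ = 0) (s : E) :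
    ∫⁻ x, ENNReal.ofReal (Real.cosh ‖s + Φ x‖) ∂μ ≤
      ENNReal.ofReal (Real.exp (c ^ 2)) * ENNReal.ofReal (Real.cosh ‖s‖) := by
  have hint : Integrable Φ μ := Integrable.of_bound hΦ.aestronglyMeasurable c (ae_of_all _ hc)
  have hint2 : Integrable (fun x => Real.cosh ‖s‖ * Real.exp (c ^ 2) +
      Real.sinh ‖s‖ / ‖s‖ * inner ℝ s (Φ x)) μ :=
    (integrable_const _).add ((hint.const_inner s).const_mul _)
  have hle : ∀ x, Real.cosh ‖s + Φ x‖ ≤ Real.cosh ‖s‖ * Real.exp (c ^ 2) +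
      Real.sinh ‖s‖ / ‖s‖ * inner ℝ s (Φ x) := by
    intro x
    have := (Real.cosh_pos ‖s‖).le
    refine (cosh_norm_add_le s (Φ x)).trans ?_
    gcongr
    exact hc x
  calc _ ≤ ∫⁻ x, ENNReal.ofReal (Real.cosh ‖s‖ * Real.exp (c ^ 2) +
        Real.sinh ‖s‖ / ‖s‖ * inner ℝ s (Φ x)) ∂μ :=
        lintegral_mono fun x => ENNReal.ofReal_le_ofReal (hle x)
    _ = ENNReal.ofReal (∫ x, (Real.cosh ‖s‖ * Real.exp (c ^ 2) +
        Real.sinh ‖s‖ / ‖s‖ * inner ℝ s (Φ x)) ∂μ) :=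
        (ofReal_integral_eq_lintegral_ofReal hint2
          (ae_of_all _ fun x => (Real.cosh_pos _).le.trans (hle x))).symm
    _ = _ := by
        rw [integral_add (integrable_const _) ((hint.const_inner s).const_mul _),
          integral_const_mul (Real.sinh ‖s‖ / ‖s‖), integral_inner hint, h0, inner_zero_right, mul_zero, add_zero,
          integral_const, probReal_univ, one_smul, mul_comm,
          ENNReal.ofReal_mul (Real.exp_pos _).le]

variable {Ω : Type*} [MeasurableSpace Ω] {P : Measure Ω} [IsProbabilityMeasure P]

/-- The last point is independent of the earlier ones, so their joint law is a product. Integrating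
over the last point first costs one factor `exp (c²)`. -/
theorem lintegral_cosh_norm_sum_le {μ : Measure X} [IsProbabilityMeasure μ]
    {ξ : ℕ → Ω → X} (hξ : ∀ i, Measurable (ξ i)) (hlaw : ∀ i, P.map (ξ i) = μ)
    (hind : iIndepFun ξ P) {Φ : X → E} (hΦ : StronglyMeasurable Φ) {c : ℝ}
    (hc : ∀ x, ‖Φ x‖ ≤ c) (h0 : ∫ x, Φ x ∂μ = 0) (m : ℕ) :
    ∫⁻ ω, ENNReal.ofReal (Real.cosh ‖∑ i ∈ Finset.range m, Φ (ξ i ω)‖) ∂P ≤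
      ENNReal.ofReal (Real.exp (m * c ^ 2)) := by
  induction m with
  | zero => simp
  | succ m ih =>
    let Y : Ω → (Finset.range m → X) := fun ω i => ξ i ω
    have hY : Measurable Y := measurable_pi_lambda _ fun i => hξ i
    have hYX : IndepFun Y (ξ m) P := by
      have := hind.indepFun_finset (Finset.range m) {m} (by simp) hξ
      exact this.comp (φ := id) (ψ := fun g : ({m} : Finset ℕ) → X => g ⟨m, by simp⟩)
        measurable_id (measurable_pi_apply _)
    have hmap := (indepFun_iff_map_prod_eq_prod_map_map hY.aemeasurable (hξ m).aemeasurable).1 hYX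
    rw [hlaw] at hmap
    let S : (Finset.range m → X) → E := fun y => ∑ i, Φ (y i)
    have hS : StronglyMeasurable S := by
      refine Finset.stronglyMeasurable_fun_sum _ fun i _ => ?_
      exact hΦ.comp_measurable (measurable_pi_apply i)
    have hSY : ∀ ω, S (Y ω) = ∑ i ∈ Finset.range m, Φ (ξ i ω) := fun ω =>
      Finset.sum_coe_sort (Finset.range m) fun i => Φ (ξ i ω)
    let F : (Finset.range m → X) × X → ENNReal :=
      fun p => ENNReal.ofReal (Real.cosh ‖S p.1 + Φ p.2‖)
    have hF : Measurable F := by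
      have h1 : StronglyMeasurable fun p : (Finset.range m → X) × X => S p.1 + Φ p.2 :=
        (hS.comp_measurable measurable_fst).add (hΦ.comp_measurable measurable_snd)
      exact ENNReal.measurable_ofReal.comp (Real.measurable_cosh.comp h1.norm.measurable)
    calc _ = ∫⁻ ω, F (Y ω, ξ m ω) ∂P := by
          simp only [F, hSY, Finset.sum_range_succ]
      _ = ∫⁻ p, F p ∂((P.map Y).prod μ) := by
          rw [← hmap, lintegral_map hF (hY.prodMk (hξ m))]
      _ = ∫⁻ y, ∫⁻ x, F (y, x) ∂μ ∂(P.map Y) := lintegral_prod _ hF.aemeasurable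
      _ ≤ ∫⁻ y, ENNReal.ofReal (Real.exp (c ^ 2)) * ENNReal.ofReal (Real.cosh ‖S y‖) ∂(P.map Y) :=
          lintegral_mono fun y => lintegral_cosh_norm_add_le μ hΦ hc h0 (S y)
      _ = ENNReal.ofReal (Real.exp (c ^ 2)) *
            ∫⁻ ω, ENNReal.ofReal (Real.cosh ‖∑ i ∈ Finset.range m, Φ (ξ i ω)‖) ∂P := by
          have h1 : Measurable fun y => ENNReal.ofReal (Real.cosh ‖S y‖) :=
            ENNReal.measurable_ofReal.comp (Real.measurable_cosh.comp hS.norm.measurable)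
          rw [lintegral_const_mul _ h1, lintegral_map h1 hY]
          simp only [hSY]
      _ ≤ ENNReal.ofReal (Real.exp (c ^ 2)) * ENNReal.ofReal (Real.exp (m * c ^ 2)) := by gcongr
      _ = _ := by
          rw [← ENNReal.ofReal_mul (Real.exp_pos _).le, ← Real.exp_add]
          congr 2
          push_cast
          ring

/-- A Hoeffding inequality for sums of independent random vectors in a Hilbert space. -/
theorem measure_norm_sum_ge_le {μ : Measure X} [IsProbabilityMeasure μ]
    {ξ : ℕ → Ω → X} (hξ : ∀ i, Measurable (ξ i)) (hlaw : ∀ i, P.map (ξ i) = μ)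
    (hind : iIndepFun ξ P) {Φ : X → E} (hΦ : StronglyMeasurable Φ) {c : ℝ} (hc0 : 0 < c)
    (hc : ∀ x, ‖Φ x‖ ≤ c) (h0 : ∫ x, Φ x ∂μ = 0) {m : ℕ} (hm : 1 ≤ m) {t : ℝ} (ht : 0 ≤ t) :
    P {ω | t ≤ ‖∑ i ∈ Finset.range m, Φ (ξ i ω)‖} ≤
      ENNReal.ofReal (2 * Real.exp (-(t ^ 2 / (4 * m * c ^ 2)))) := by
  have hm' : (0 : ℝ) < m := by exact_mod_cast hm
  -- The minimiser of the Chernoff exponent `m l² c² - l t`.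
  set l : ℝ := t / (2 * m * c ^ 2) with hl
  have hl0 : 0 ≤ l := by positivity
  have key := lintegral_cosh_norm_sum_le hξ hlaw hind (Φ := fun x => l • Φ x)
    (hΦ.const_smul l) (c := l * c)
    (fun x => by rw [norm_smul, Real.norm_of_nonneg hl0]; gcongr; exact hc x)
    (by rw [integral_smul, h0, smul_zero]) m
  have hmeas : Measurable fun ω =>
      ENNReal.ofReal (Real.cosh ‖∑ i ∈ Finset.range m, l • Φ (ξ i ω)‖) := by
    have : StronglyMeasurable fun ω => ∑ i ∈ Finset.range m, l • Φ (ξ i ω) :=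
      Finset.stronglyMeasurable_fun_sum _ fun i _ => (hΦ.comp_measurable (hξ i)).const_smul l
    exact ENNReal.measurable_ofReal.comp (Real.measurable_cosh.comp this.norm.measurable)
  have hpos : 0 < Real.exp (l * t) / 2 := by positivity
  have hsub : {ω | t ≤ ‖∑ i ∈ Finset.range m, Φ (ξ i ω)‖} ⊆
      {ω | ENNReal.ofReal (Real.exp (l * t) / 2) ≤
        ENNReal.ofReal (Real.cosh ‖∑ i ∈ Finset.range m, l • Φ (ξ i ω)‖)} := by
    intro ω hω
    refine ENNReal.ofReal_le_ofReal ?_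
    have h1 : l * t ≤ ‖∑ i ∈ Finset.range m, l • Φ (ξ i ω)‖ := by
      rw [← Finset.smul_sum, norm_smul, Real.norm_of_nonneg hl0]
      exact mul_le_mul_of_nonneg_left hω hl0
    have h2 := Real.exp_le_exp.2 h1
    rw [Real.cosh_eq]
    have h3 := Real.exp_pos (-‖∑ i ∈ Finset.range m, l • Φ (ξ i ω)‖)
    linarith
  refine (measure_mono hsub).trans ((meas_ge_le_lintegral_div hmeas.aemeasurable
    (by simpa using hpos) ENNReal.ofReal_ne_top).trans ?_)
  refine (ENNReal.div_le_div_right key _).trans (le_of_eq ?_)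
  rw [← ENNReal.ofReal_div_of_pos hpos]
  congr 1
  have : -(t ^ 2 / (4 * m * c ^ 2)) = m * (l * c) ^ 2 - l * t := by
    rw [hl]; field_simp; ring
  rw [this, Real.exp_sub]
  field_simp

end Concentration

/-! ### Resolvents of positive operators, and perturbation and limit of the regularized energy. -/

section Resolvent

variable {H : Type*} [NormedAddCommGroup H] [InnerProductSpace ℝ H] [CompleteSpace H]

/-- The regularized inverse `(T + r I)⁻¹`. -/
def regInv (T : H →L[ℝ] H) (r : ℝ) : H →L[ℝ] H := Ring.inverse (T + r • 1)

omit [CompleteSpace H] in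
theorem regEnergy_eq (T : H →L[ℝ] H) (r : ℝ) (h : H) :
    regEnergy T r h = 1 / 2 * inner ℝ (regInv T r (regInv T r (T h))) h := by
  simp [regEnergy, regInv, pow_two]

variable {T : H →L[ℝ] H} {r : ℝ}

theorem mul_regInv (hT : T.IsPositive) (hr : 0 < r) : (T + r • 1) * regInv T r = 1 :=
  Ring.mul_inverse_cancel _ (isUnit_add_smul_one T hT hr)

theorem regInv_mul (hT : T.IsPositive) (hr : 0 < r) : regInv T r * (T + r • 1) = 1 :=
  Ring.inverse_mul_cancel _ (isUnit_add_smul_one T hT hr)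

theorem apply_regInv (hT : T.IsPositive) (hr : 0 < r) (x : H) : T (regInv T r x) = x - r • regInv T r x := by
  have := congrArg (fun S : H →L[ℝ] H => S x) (mul_regInv hT hr)
  simp at this
  exact eq_sub_of_add_eq this

theorem regInv_apply (hT : T.IsPositive) (hr : 0 < r) (x : H) : regInv T r (T x) = x - r • regInv T r x := by
  have := congrArg (fun S : H →L[ℝ] H => S x) (regInv_mul hT hr)
  simp at this
  exact eq_sub_of_add_eq this

theorem regInv_comm (hT : T.IsPositive) (hr : 0 < r) (x : H) : regInv T r (T x) = T (regInv T r x) := by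
  rw [regInv_apply hT hr, apply_regInv hT hr]

/-- With `y = (T + r)⁻¹ x`, expand `‖T y + r y‖²`: positivity makes the cross term nonnegative. Both
`T (T + r)⁻¹` and `r (T + r)⁻¹` are therefore contractions. -/
theorem norm_sq_regInv_le (hT : T.IsPositive) (hr : 0 < r) (x : H) :
    ‖T (regInv T r x)‖ ^ 2 + (r * ‖regInv T r x‖) ^ 2 ≤ ‖x‖ ^ 2 := by
  have e1 : x = T (regInv T r x) + r • regInv T r x := by rw [apply_regInv hT hr]; abel
  conv_rhs => rw [e1]
  have h1 : 0 ≤ inner ℝ (T (regInv T r x)) (regInv T r x) := hT.inner_nonneg_left _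
  rw [norm_add_sq_real, inner_smul_right, norm_smul, Real.norm_of_nonneg hr.le]
  nlinarith [mul_nonneg hr.le h1]

theorem norm_apply_regInv_le (hT : T.IsPositive) (hr : 0 < r) (x : H) : ‖T (regInv T r x)‖ ≤ ‖x‖ := by
  refine le_of_sq_le_sq ?_ (norm_nonneg _)
  nlinarith [norm_sq_regInv_le hT hr x, sq_nonneg (r * ‖regInv T r x‖)]

theorem mul_norm_regInv_le (hT : T.IsPositive) (hr : 0 < r) (x : H) : r * ‖regInv T r x‖ ≤ ‖x‖ := by
  refine le_of_sq_le_sq ?_ (norm_nonneg _)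
  nlinarith [norm_sq_regInv_le hT hr x, sq_nonneg ‖T (regInv T r x)‖]

theorem norm_regInv_le (hT : T.IsPositive) (hr : 0 < r) (x : H) : ‖regInv T r x‖ ≤ ‖x‖ / r := by
  rw [le_div_iff₀ hr, mul_comm]
  exact mul_norm_regInv_le hT hr x

/-- Difference of the regularized pseudoinverses `(T + r I)⁻² T` of two positive operators. -/
theorem regInv_sq_sub {A B : H →L[ℝ] H} (hA : A.IsPositive) (hB : B.IsPositive) {r : ℝ}
    (hr : 0 < r) (h : H) :
    regInv A r (regInv A r (A h)) - regInv B r (regInv B r (B h)) =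
      regInv A r (regInv A r (A ((B - A) (B (regInv B r (regInv B r h)))))) +
      r ^ 2 • regInv A r (regInv A r ((A - B) (regInv B r (regInv B r h)))) := by
  have a1 := regInv_mul hA hr
  have b1 := mul_regInv hB hr
  have hBc : B * regInv B r = regInv B r * B := by
    ext x; simp [regInv_comm hB hr]
  set R := regInv A r
  set Q := regInv B r
  have key : R * R * A - Q * Q * B =
      R * R * A * (B - A) * B * Q * Q + r ^ 2 • (R * R * (A - B) * Q * Q) := by
    set U := A + r • (1 : H →L[ℝ] H) with hU
    set V := B + r • (1 : H →L[ℝ] H) with hV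
    -- The mixed terms `2 r A B` cancel between the two expansions.
    have e : A * (B - A) * B + r ^ 2 • (A - B) = A * V * V - U * U * B := by
      rw [hU, hV]
      simp only [mul_add, add_mul, mul_sub, sub_mul, smul_mul_assoc, mul_smul_comm, one_mul,
        mul_one, smul_sub, smul_add, smul_smul, mul_assoc, pow_two]
      abel
    have e2 : R * R * A * (B - A) * B * Q * Q + r ^ 2 • (R * R * (A - B) * Q * Q) =
        R * R * (A * (B - A) * B + r ^ 2 • (A - B)) * Q * Q := by
      simp only [mul_add, add_mul, smul_mul_assoc, mul_smul_comm, mul_assoc]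
    rw [e2, e, mul_sub, sub_mul, sub_mul]
    congr 1
    · rw [show R * R * (A * V * V) * Q * Q = R * R * A * V * (V * Q) * Q by noncomm_ring, b1,
        mul_one, mul_assoc _ V Q, b1, mul_one]
    · rw [show R * R * (U * U * B) * Q * Q = R * (R * U) * U * B * Q * Q by noncomm_ring, a1,
        mul_one, a1, one_mul, hBc, mul_assoc Q B Q, hBc, mul_assoc]
  have := congrArg (fun S : H →L[ℝ] H => S h) key
  simpa using this

/-- The regularized energy is Lipschitz in the operator. -/
theorem abs_regEnergy_sub_le {A B : H →L[ℝ] H} (hA : A.IsPositive) (hB : B.IsPositive) {r k : ℝ}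
    (hr : 0 < r) (hAk : ‖A‖ ≤ k) (hBk : ‖B‖ ≤ k) {ε : ℝ} (hε : ‖A - B‖ ≤ ε) (h : H) :
    |regEnergy A r h - regEnergy B r h| ≤ 1 / 2 * ((k ^ 2 + r ^ 2) / r ^ 4 * ε * ‖h‖ ^ 2) := by
  have hε0 : 0 ≤ ε := (norm_nonneg _).trans hε
  have hk0 : 0 ≤ k := (norm_nonneg _).trans hAk
  have hε' : ‖B - A‖ ≤ ε := by rwa [norm_sub_rev]
  set w := regInv B r (regInv B r h) with hw
  have hsq : ∀ {S : H →L[ℝ] H}, S.IsPositive → ∀ x, ‖regInv S r (regInv S r x)‖ ≤ ‖x‖ / r ^ 2 := by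
    intro S hS x
    calc _ ≤ ‖regInv S r x‖ / r := norm_regInv_le hS hr _
      _ ≤ ‖x‖ / r / r := by gcongr; exact norm_regInv_le hS hr _
      _ = _ := by rw [div_div, pow_two]
  have hw1 : ‖w‖ ≤ ‖h‖ / r ^ 2 := hsq hB h
  have h1 : ‖A ((B - A) (B w))‖ ≤ k * (ε * (k * (‖h‖ / r ^ 2))) :=
    A.le_of_opNorm_le_of_le hAk ((B - A).le_of_opNorm_le_of_le hε' (B.le_of_opNorm_le_of_le hBk hw1))
  have h2 : ‖(A - B) w‖ ≤ ε * (‖h‖ / r ^ 2) := (A - B).le_of_opNorm_le_of_le hε hw1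
  have h3 : ‖regInv A r (regInv A r (A h)) - regInv B r (regInv B r (B h))‖ ≤
      k * (ε * (k * (‖h‖ / r ^ 2))) / r ^ 2 + r ^ 2 * (ε * (‖h‖ / r ^ 2) / r ^ 2) := by
    rw [regInv_sq_sub hA hB hr]
    refine (norm_add_le _ _).trans (add_le_add ((hsq hA _).trans (by gcongr)) ?_)
    rw [norm_smul, Real.norm_of_nonneg (sq_nonneg r)]
    gcongr
    exact (hsq hA _).trans (by gcongr)
  rw [regEnergy_eq, regEnergy_eq, ← mul_sub, ← inner_sub_left, abs_mul,
    abs_of_pos (by norm_num : (0 : ℝ) < 1 / 2)]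
  gcongr
  refine (abs_real_inner_le_norm _ _).trans ?_
  refine (mul_le_mul_of_nonneg_right h3 (norm_nonneg h)).trans (le_of_eq ?_)
  field_simp

/-- On the range of `B`, the regularized energies of `A` and `B` differ by `O(‖A - B‖ / r)`. -/
theorem abs_regEnergy_sub_apply_le {A B : H →L[ℝ] H} (hA : A.IsPositive) (hB : B.IsPositive)
    {r : ℝ} (hr : 0 < r) {ε : ℝ} (hε : ‖A - B‖ ≤ ε) (g : H) :
    |regEnergy A r (B g) - regEnergy B r (B g)| ≤ ε / r * (‖g‖ * ‖B g‖) := by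
  have hε0 : 0 ≤ ε := (norm_nonneg _).trans hε
  have hε' : ‖B - A‖ ≤ ε := by rwa [norm_sub_rev]
  have hw : regInv B r (regInv B r (B g)) = regInv B r (B (regInv B r g)) := by
    rw [regInv_comm hB hr]
  set w := regInv B r (regInv B r (B g)) with hw'
  have hw1 : ‖w‖ ≤ ‖g‖ / r := by
    refine (norm_regInv_le hB hr _).trans ?_
    rw [regInv_comm hB hr]
    gcongr
    exact norm_apply_regInv_le hB hr g
  have hw2 : ‖B w‖ ≤ ‖g‖ := by
    rw [hw]
    refine (norm_apply_regInv_le hB hr _).trans ?_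
    exact norm_apply_regInv_le hB hr g
  -- One resolvent of `A` pairs with `A` into a contraction, so only one factor `1 / r` remains; `B
  -- w` costs none.
  have h1 : ‖regInv A r (regInv A r (A ((B - A) (B w))))‖ ≤ ε * ‖g‖ / r := by
    refine (norm_regInv_le hA hr _).trans ?_
    rw [regInv_comm hA hr]
    gcongr
    exact (norm_apply_regInv_le hA hr _).trans ((B - A).le_of_opNorm_le_of_le hε' hw2)
  have h2 : ‖r ^ 2 • regInv A r (regInv A r ((A - B) w))‖ ≤ ε * (‖g‖ / r) := by
    rw [norm_smul, Real.norm_of_nonneg (sq_nonneg r), pow_two, mul_assoc]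
    calc _ ≤ r * ‖regInv A r ((A - B) w)‖ := by gcongr; exact mul_norm_regInv_le hA hr _
      _ ≤ ‖(A - B) w‖ := mul_norm_regInv_le hA hr _
      _ ≤ _ := (A - B).le_of_opNorm_le_of_le hε hw1
  have h3 : ‖regInv A r (regInv A r (A (B g))) - regInv B r (regInv B r (B (B g)))‖ ≤
      ε * ‖g‖ / r + ε * (‖g‖ / r) := by
    rw [regInv_sq_sub hA hB hr]
    exact (norm_add_le _ _).trans (add_le_add h1 h2)
  rw [regEnergy_eq, regEnergy_eq, ← mul_sub, ← inner_sub_left, abs_mul,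
    abs_of_pos (by norm_num : (0 : ℝ) < 1 / 2)]
  have h4 := (abs_real_inner_le_norm _ _).trans
    (mul_le_mul_of_nonneg_right h3 (norm_nonneg (B g)))
  refine (mul_le_mul_of_nonneg_left h4 (by norm_num)).trans (le_of_eq ?_)
  ring

/-- The regularized energy ignores the kernel component. -/
theorem regEnergy_add_ker {T : H →L[ℝ] H} (hT : T.IsPositive) {r : ℝ} (hr : 0 < r) (q n : H)
    (hn : T n = 0) : regEnergy T r (q + n) = regEnergy T r q := by
  have hs : ∀ a b, inner ℝ (T a) b = inner ℝ a (T b) := hT.isSymmetric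
  have h1 : inner ℝ (regInv T r (regInv T r (T q))) n = 0 := by
    rw [regInv_comm hT hr, regInv_comm hT hr, hs, hn, inner_zero_right]
  rw [regEnergy_eq, regEnergy_eq, map_add, hn, add_zero, inner_add_right, h1, add_zero]

/-- `T (T + r I)⁻¹ g → g` as `r → 0⁺`, for `g` orthogonal to the kernel of `T`. -/
theorem tendsto_apply_regInv {T : H →L[ℝ] H} (hT : T.IsPositive) {g : H} (hg : g ∈ (T.ker)ᗮ) :
    Tendsto (fun r => T (regInv T r g)) (𝓝[>] 0) (𝓝 g) := by
  have hcl : g ∈ closure (Set.range T) := by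
    have h1 := T.orthogonal_ker
    rw [hT.isSelfAdjoint.adjoint_eq] at h1
    rw [h1] at hg
    exact hg
  rw [Metric.tendsto_nhds]
  intro ε hε
  obtain ⟨_, ⟨z, rfl⟩, hz⟩ := Metric.mem_closure_iff.1 hcl (ε / 2) (by positivity)
  have hlim : Tendsto (fun r : ℝ => r * ‖z‖) (𝓝[>] 0) (𝓝 0) := by
    have : Tendsto (fun r : ℝ => r * ‖z‖) (𝓝 0) (𝓝 (0 * ‖z‖)) := tendsto_id.mul_const _
    rw [zero_mul] at this
    exact this.mono_left nhdsWithin_le_nhds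
  filter_upwards [hlim.eventually (gt_mem_nhds (half_pos hε)), self_mem_nhdsWithin] with r hr1 hr
  have hr : 0 < r := hr
  rw [dist_comm, dist_eq_norm]
  -- The defect is `r (T + r)⁻¹ g`, split along an approximation `T z` of `g`, which exists because
  -- `(ker T)ᗮ` is the closure of the range of a self-adjoint `T`.
  have e : g - T (regInv T r g) = r • regInv T r (g - T z) + r • regInv T r (T z) := by
    rw [apply_regInv hT hr, map_sub, smul_sub]; abel
  have h1 : ‖r • regInv T r (g - T z)‖ ≤ ‖g - T z‖ := by
    rw [norm_smul, Real.norm_of_nonneg hr.le]; exact mul_norm_regInv_le hT hr _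
  have h2 : ‖r • regInv T r (T z)‖ ≤ r * ‖z‖ := by
    rw [norm_smul, Real.norm_of_nonneg hr.le, regInv_comm hT hr]
    gcongr
    exact norm_apply_regInv_le hT hr _
  rw [e]
  have := norm_add_le (r • regInv T r (g - T z)) (r • regInv T r (T z))
  have hz' : ‖g - T z‖ < ε / 2 := by rwa [dist_eq_norm] at hz
  linarith

/-- If `T† T h` lies in the domain of `T†`, then `h = T g + n` with `n ∈ ker T` and
`g = T† (T† T) h ∈ (ker T)ᗮ`. -/
theorem apply_sub_pinvProj {T : H →L[ℝ] H} (hT : T.IsPositive) (h : H) (hh : InPinvDomain T h) :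
    pinvProj T h hh ∈ (T.ker)ᗮ ∧ T (h - T (pinvProj T h hh)) = 0 := by
  have hro : (T.range)ᗮ = T.ker := by
    have := T.orthogonal_range
    rwa [hT.isSelfAdjoint.adjoint_eq] at this
  have s1 := pinv_spec T ⟨T h, apply_mem_pinv_domain T h⟩
  have s2 := pinv_spec T ⟨pinvComp T h, hh⟩
  refine ⟨s2.1, ?_⟩
  have k1 : T (h - pinvComp T h) ∈ (T.range)ᗮ := by
    rw [map_sub]; exact s1.2
  have k2 : T (h - pinvComp T h) = 0 := inner_self_eq_zero.1
    (Submodule.inner_right_of_mem_orthogonal (𝕜 := ℝ)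
      (LinearMap.mem_range_self (T : H →ₗ[ℝ] H) _) k1)
  have k3 : pinvComp T h - T (pinvProj T h hh) ∈ T.ker := hro ▸ s2.2
  have k4 : T (pinvComp T h - T (pinvProj T h hh)) = 0 := k3
  have : h - T (pinvProj T h hh) = (h - pinvComp T h) + (pinvComp T h - T (pinvProj T h hh)) := by
    abel
  rw [this, map_add, k2, k4, add_zero]

/-- Since `T h = T (T g)`, the filtered vector is `(T (T + r)⁻¹)² g`. The outer factor is a
contraction, so applying `tendsto_apply_regInv` to the inner one suffices. -/
theorem tendsto_regEnergy {T : H →L[ℝ] H} (hT : T.IsPositive) (h : H) (hh : InPinvDomain T h) :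
    Tendsto (fun r => regEnergy T r h) (𝓝[>] 0) (𝓝 (pinvEnergy T h hh)) := by
  obtain ⟨hg, hn⟩ := apply_sub_pinvProj hT h hh
  set g := pinvProj T h hh with hgdef
  have hTh : T h = T (T g) := by rw [map_sub] at hn; exact sub_eq_zero.1 hn
  have h1 := tendsto_apply_regInv hT hg
  have h2 : Tendsto (fun r => T (regInv T r (T (regInv T r g)))) (𝓝[>] 0) (𝓝 g) := by
    have h3 : Tendsto (fun r => T (regInv T r (T (regInv T r g) - g))) (𝓝[>] 0) (𝓝 0) := by
      refine squeeze_zero_norm' ?_ (tendsto_iff_norm_sub_tendsto_zero.1 h1)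
      filter_upwards [self_mem_nhdsWithin] with r hr
      exact norm_apply_regInv_le hT hr _
    have h4 := h3.add h1
    rw [zero_add] at h4
    refine h4.congr fun r => ?_
    rw [map_sub, map_sub]; abel
  unfold pinvEnergy
  refine ((h2.inner tendsto_const_nhds).const_mul (1 / 2)).congr' ?_
  filter_upwards [self_mem_nhdsWithin] with r hr
  simp only [regEnergy_eq, hTh, regInv_comm hT hr]

end Resolvent

/-! ### Feature vectors, gramians and their image in the tensor square. -/

section FeatureMap

variable {X : Type*} (H : Type*) [NormedAddCommGroup H] [InnerProductSpace ℝ H] [CompleteSpace H]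
  [RKHS ℝ H X ℝ]

theorem inner_feat_right (f : H) (x : X) : inner ℝ f (feat H x) = f x := by
  simp [feat, RKHS.inner_kerFun]

theorem kappa_nonneg : 0 ≤ kappa H := Real.sqrt_nonneg _

theorem norm_sq_feat (x : X) : ‖feat H x‖ ^ 2 = kerR H x x := by
  rw [← real_inner_self_eq_norm_sq, inner_feat]

open scoped TensorProduct in
/-- The feature vector of the squared kernel, in the completed tensor square of `H`. -/
def tensorFeat (x : X) : UniformSpace.Completion (H ⊗[ℝ] H) :=
  ((feat H x ⊗ₜ[ℝ] feat H x : H ⊗[ℝ] H) : UniformSpace.Completion (H ⊗[ℝ] H))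

theorem norm_tensorFeat (x : X) : ‖tensorFeat H x‖ = ‖feat H x‖ ^ 2 := by
  simp [tensorFeat, pow_two]

open scoped TensorProduct in
-- Turns matrix coefficients of rank-one operators into tensor inner products, so that Hilbert space
-- concentration applies to operators.
theorem inner_tensorFeat (x : X) (a b : H) :
    inner ℝ ((a ⊗ₜ[ℝ] b : H ⊗[ℝ] H) : UniformSpace.Completion (H ⊗[ℝ] H)) (tensorFeat H x) =
      inner ℝ (InnerProductSpace.rankOne ℝ (feat H x) (feat H x) a) b := by
  simp [tensorFeat, inner_smul_left, real_inner_comm]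

variable [TopologicalSpace X] [CompactSpace X]

theorem norm_feat_le (hK : Continuous fun p : X × X => kerR H p.1 p.2) (x : X) :
    ‖feat H x‖ ≤ kappa H := by
  have hc : Continuous fun x : X => kerR H x x :=
    Continuous.comp (g := fun p : X × X => kerR H p.1 p.2) (f := fun x : X => (x, x)) hK
      (by fun_prop)
  refine Real.le_sqrt_of_sq_le ?_
  rw [norm_sq_feat]
  exact le_ciSup (isCompact_range hc).bddAbove x

omit [CompactSpace X] in
theorem continuous_tensorFeat (hK : Continuous fun p : X × X => kerR H p.1 p.2) :
    Continuous (tensorFeat H : X → _) := by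
  have hf := continuous_feat H hK
  refine UniformSpace.Completion.continuous_coe _ |>.comp ?_
  rw [continuous_iff_continuousAt]
  intro x
  refine tendsto_iff_norm_sub_tendsto_zero.2 ?_
  have h : Tendsto (fun y => ‖feat H y - feat H x‖ * ‖feat H y‖ +
      ‖feat H x‖ * ‖feat H y - feat H x‖) (𝓝 x) (𝓝 0) := by
    have : Continuous fun y => ‖feat H y - feat H x‖ * ‖feat H y‖ +
      ‖feat H x‖ * ‖feat H y - feat H x‖ := by fun_prop
    simpa using this.tendsto x
  refine squeeze_zero (fun _ => norm_nonneg _) (fun y => ?_) h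
  have e : TensorProduct.tmul ℝ (feat H y) (feat H y) - TensorProduct.tmul ℝ (feat H x) (feat H x) =
      TensorProduct.tmul ℝ (feat H y - feat H x) (feat H y) +
      TensorProduct.tmul ℝ (feat H x) (feat H y - feat H x) := by
    rw [TensorProduct.sub_tmul, TensorProduct.tmul_sub]; abel
  rw [e]
  refine (norm_add_le _ _).trans (le_of_eq ?_)
  rw [TensorProduct.norm_tmul, TensorProduct.norm_tmul]

variable [MeasurableSpace X] [OpensMeasurableSpace X] (μ : Measure X) [IsProbabilityMeasure μ]

/-- The centred feature vector of the squared kernel. -/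
def centredFeat (x : X) : UniformSpace.Completion (TensorProduct ℝ H H) :=
  tensorFeat H x - ∫ y, tensorFeat H y ∂μ

theorem gramian_apply (hK : Continuous fun p : X × X => kerR H p.1 p.2) (a b : H) :
    inner ℝ (gramian H μ a) b =
      ∫ x, inner ℝ (InnerProductSpace.rankOne ℝ (feat H x) (feat H x) a) b ∂μ := by
  have hi := integrable_gramian H μ hK
  rw [gramian, ContinuousLinearMap.integral_apply hi, real_inner_comm,
    ← integral_inner (hi.apply_continuousLinearMap a)]
  simp only [real_inner_comm]

theorem gramian_isPositive (hK : Continuous fun p : X × X => kerR H p.1 p.2) :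
    (gramian H μ).IsPositive := by
  refine (ContinuousLinearMap.isPositive_iff _).2 ⟨?_, fun a => ?_⟩
  · intro a b
    change inner ℝ (gramian H μ a) b = inner ℝ a (gramian H μ b)
    rw [real_inner_comm _ a, gramian_apply H μ hK, gramian_apply H μ hK]
    refine integral_congr_ae (ae_of_all _ fun x => ?_)
    simp [inner_smul_left, real_inner_comm, mul_comm]
  · rw [gramian_apply H μ hK]
    exact integral_nonneg fun x =>
      (InnerProductSpace.isPositive_rankOne_self (feat H x)).inner_nonneg_left a

omit [OpensMeasurableSpace X] in
theorem norm_gramian_le (hK : Continuous fun p : X × X => kerR H p.1 p.2) :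
    ‖gramian H μ‖ ≤ kappa H ^ 2 := by
  have := norm_integral_le_of_norm_le_const (μ := μ)
    (f := fun x => InnerProductSpace.rankOne ℝ (feat H x) (feat H x)) (C := kappa H ^ 2)
    (ae_of_all _ fun x => by
      rw [InnerProductSpace.norm_rankOne, ← pow_two]
      gcongr
      exact norm_feat_le H hK x)
  simpa [gramian] using this

omit [MeasurableSpace X] [OpensMeasurableSpace X] in
theorem norm_empGramian_le (hK : Continuous fun p : X × X => kerR H p.1 p.2) {m : ℕ}
    (hm : 1 ≤ m) (s : Fin m → X) : ‖empGramian H s‖ ≤ kappa H ^ 2 := by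
  have hm' : (0 : ℝ) < m := by exact_mod_cast hm
  rw [empGramian, norm_smul, Real.norm_of_nonneg (by positivity), inv_mul_le_iff₀ hm']
  refine (norm_sum_le _ _).trans ?_
  refine (Finset.sum_le_card_nsmul _ _ (kappa H ^ 2) fun i _ => ?_).trans (by simp)
  rw [InnerProductSpace.norm_rankOne, ← pow_two]
  gcongr
  exact norm_feat_le H hK _

omit [CompactSpace X] [IsProbabilityMeasure μ] in
-- Second countability of `X` makes the range of the feature map separable; `H` itself need not be.
theorem stronglyMeasurable_centredFeat [SecondCountableTopology X]
    (hK : Continuous fun p : X × X => kerR H p.1 p.2) :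
    StronglyMeasurable (centredFeat H μ) :=
  (continuous_tensorFeat H hK).stronglyMeasurable.sub stronglyMeasurable_const

theorem integrable_tensorFeat (hK : Continuous fun p : X × X => kerR H p.1 p.2) :
    Integrable (tensorFeat H) μ :=
  (continuous_tensorFeat H hK).integrable_of_hasCompactSupport (HasCompactSupport.of_compactSpace _)

theorem integral_centredFeat (hK : Continuous fun p : X × X => kerR H p.1 p.2) :
    ∫ x, centredFeat H μ x ∂μ = 0 := by
  simp only [centredFeat]
  rw [integral_sub (integrable_tensorFeat H μ hK) (integrable_const _)]
  simp

omit [OpensMeasurableSpace X] in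
theorem norm_centredFeat_le (hK : Continuous fun p : X × X => kerR H p.1 p.2) (x : X) :
    ‖centredFeat H μ x‖ ≤ 2 * kappa H ^ 2 := by
  have h1 : ∀ y : X, ‖tensorFeat H y‖ ≤ kappa H ^ 2 := fun y => by
    rw [norm_tensorFeat]
    gcongr
    exact norm_feat_le H hK y
  have h2 := norm_integral_le_of_norm_le_const (μ := μ) (ae_of_all _ h1)
  rw [probReal_univ, mul_one] at h2
  refine (norm_sub_le _ _).trans ?_
  linarith [h1 x]

/-- The operator norm of `W_{c,m} - W_c` is at most the norm of the centred feature mean. -/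
theorem norm_empGramian_sub_gramian_le (hK : Continuous fun p : X × X => kerR H p.1 p.2)
    {m : ℕ} (hm : 1 ≤ m) (s : Fin m → X) :
    ‖empGramian H s - gramian H μ‖ ≤ (m : ℝ)⁻¹ * ‖∑ i, centredFeat H μ (s i)‖ := by
  have hm' : (0 : ℝ) < m := by exact_mod_cast hm
  have key : ∀ a b : H, inner ℝ ((empGramian H s - gramian H μ) a) b =
      inner ℝ ((TensorProduct.tmul ℝ a b : TensorProduct ℝ H H) :
        UniformSpace.Completion (TensorProduct ℝ H H))
        ((m : ℝ)⁻¹ • ∑ i, centredFeat H μ (s i)) := by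
    intro a b
    have e1 : ∑ i, centredFeat H μ (s i) =
        ∑ i, tensorFeat H (s i) - (m : ℝ) • ∫ y, tensorFeat H y ∂μ := by
      simp [centredFeat, Finset.sum_sub_distrib, Nat.cast_smul_eq_nsmul]
    rw [e1, smul_sub, smul_smul, inv_mul_cancel₀ hm'.ne', one_smul, inner_sub_right,
      inner_smul_right, inner_sum, ← integral_inner (integrable_tensorFeat H μ hK)]
    simp only [inner_tensorFeat]
    rw [← gramian_apply H μ hK, sub_apply, inner_sub_left, empGramian]
    congr 1
    rw [FunLike.coe_smul, Pi.smul_apply, _root_.sum_apply, inner_smul_left, sum_inner]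
    simp
  refine ContinuousLinearMap.opNorm_le_bound _ (by positivity) fun a => ?_
  set D := empGramian H s - gramian H μ
  -- Take `b = D a` in `key`, apply Cauchy–Schwarz, then cancel one factor `‖D a‖`.
  have h1 : ‖D a‖ * ‖D a‖ ≤ (‖a‖ * ‖D a‖) * ((m : ℝ)⁻¹ * ‖∑ i, centredFeat H μ (s i)‖) := by
    rw [← real_inner_self_eq_norm_mul_norm, key]
    refine (real_inner_le_norm _ _).trans (le_of_eq ?_)
    rw [UniformSpace.Completion.norm_coe, TensorProduct.norm_tmul, norm_smul,
      Real.norm_of_nonneg (by positivity : (0 : ℝ) ≤ (m : ℝ)⁻¹)]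
  rcases (norm_nonneg (D a)).eq_or_lt with h0 | h0
  · rw [← h0]; positivity
  · nlinarith

/-- Vectors in the kernel of the gramian vanish on the support of the measure. -/
theorem apply_eq_zero_of_mem_support (hK : Continuous fun p : X × X => kerR H p.1 p.2) {n : H}
    (hn : gramian H μ n = 0) {x : X} (hx : x ∈ μ.support) : n x = 0 := by
  have hcont : Continuous fun y : X => n y := by
    have : Continuous fun y : X => inner ℝ n (feat H y) :=
      continuous_const.inner (continuous_feat H hK)
    simpa only [inner_feat_right] using this
  have h1 := gramian_apply H μ hK n n
  rw [hn, inner_zero_left] at h1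
  have h2 : ∀ y : X, inner ℝ (InnerProductSpace.rankOne ℝ (feat H y) (feat H y) n) n = n y ^ 2 := by
    intro y
    rw [InnerProductSpace.rankOne_apply, inner_smul_left, real_inner_comm, inner_feat_right]
    simp [pow_two]
  simp only [h2] at h1
  have hi : Integrable (fun y => n y ^ 2) μ :=
    (hcont.pow 2).integrable_of_hasCompactSupport (HasCompactSupport.of_compactSpace _)
  -- The integral of `n²` vanishes, so `n` is zero almost everywhere, whereas every neighbourhood of
  -- a support point has positive mass.
  have h3 := (integral_eq_zero_iff_of_nonneg (fun y => sq_nonneg (n y)) hi).1 h1.symm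
  by_contra hne
  have hU : {y : X | n y ≠ 0} ∈ 𝓝 x := (isOpen_ne_fun hcont continuous_const).mem_nhds hne
  have h4 := (Measure.mem_support_iff_forall x).1 hx _ hU
  refine h4.ne' (measure_mono_null (fun y hy => ?_) h3)
  intro h
  exact hy (by simpa using h)

omit [TopologicalSpace X] [CompactSpace X] [MeasurableSpace X] [OpensMeasurableSpace X] in
theorem empGramian_apply_eq_zero {m : ℕ} {s : Fin m → X} {n : H} (hn : ∀ i, n (s i) = 0) :
    empGramian H s n = 0 := by
  have : ∀ i, inner ℝ (feat H (s i)) n = 0 := fun i => by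
    rw [real_inner_comm, inner_feat_right, hn]
  simp [empGramian, this]

end FeatureMap

/-! ### Deviation of the empirical gramian, sample error and consistency. -/

section GramianConcentration

variable {X : Type*} (H : Type*) [NormedAddCommGroup H] [InnerProductSpace ℝ H] [CompleteSpace H]
  [RKHS ℝ H X ℝ] [TopologicalSpace X] [CompactSpace X] [SecondCountableTopology X]
  [MeasurableSpace X] [OpensMeasurableSpace X] {μ : Measure X} [IsProbabilityMeasure μ]
  {Ω : Type*} [MeasurableSpace Ω] {P : Measure Ω} [IsProbabilityMeasure P]
  {ξ : ℕ → Ω → X}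

theorem measure_norm_empGramian_sub_ge_le (hK : Continuous fun p : X × X => kerR H p.1 p.2)
    (hξ : ∀ i, Measurable (ξ i)) (hlaw : ∀ i, P.map (ξ i) = μ) (hind : iIndepFun ξ P)
    {c : ℝ} (hc0 : 0 < c) (hc : 2 * kappa H ^ 2 ≤ c) {m : ℕ} (hm : 1 ≤ m) {L : ℝ} (hL : 0 ≤ L) :
    P {ω | 2 * c * √L / √(m : ℝ) ≤
        ‖empGramian H (fun i : Fin m => ξ i ω) - gramian H μ‖} ≤
      ENNReal.ofReal (2 * Real.exp (-L)) := by
  have hm' : (0 : ℝ) < m := by exact_mod_cast hm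
  have h := measure_norm_sum_ge_le hξ hlaw hind (stronglyMeasurable_centredFeat H μ hK) hc0
    (fun x => (norm_centredFeat_le H μ hK x).trans hc) (integral_centredFeat H μ hK) hm
    -- Chosen so that the exponent `t² / (4 m c²)` equals `L`.
    (t := 2 * c * √(m * L)) (by positivity)
  have e : (2 * c * √(m * L)) ^ 2 / (4 * m * c ^ 2) = L := by
    rw [mul_pow, Real.sq_sqrt (by positivity)]
    field_simp
    ring
  rw [e] at h
  refine (measure_mono fun ω hω => ?_).trans h
  have h1 := le_trans hω (norm_empGramian_sub_gramian_le H μ hK hm fun i : Fin m => ξ i ω)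
  rw [Fin.sum_univ_eq_sum_range (fun i => centredFeat H μ (ξ i ω)) m, ← div_eq_inv_mul,
    le_div_iff₀ hm'] at h1
  refine le_trans (le_of_eq ?_) h1
  rw [Real.sqrt_mul hm'.le]
  have hs : √(m : ℝ) * √(m : ℝ) = m := Real.mul_self_sqrt hm'.le
  have hs0 : √(m : ℝ) ≠ 0 := (Real.sqrt_pos.2 hm').ne'
  field_simp
  rw [pow_two, hs, mul_comm]

/-- Almost surely, the empirical gramians converge at the rate `√(log m / m)`. -/
theorem ae_eventually_norm_empGramian_sub_le (hK : Continuous fun p : X × X => kerR H p.1 p.2)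
    (hξ : ∀ i, Measurable (ξ i)) (hlaw : ∀ i, P.map (ξ i) = μ) (hind : iIndepFun ξ P)
    {c : ℝ} (hc0 : 0 < c) (hc : 2 * kappa H ^ 2 ≤ c) :
    ∀ᵐ ω ∂P, ∀ᶠ m : ℕ in atTop, ‖empGramian H (fun i : Fin m => ξ i ω) - gramian H μ‖ ≤
      2 * c * √(2 * Real.log m) / √(m : ℝ) := by
  -- Taking `L = 2 log m` gives probability at most `2 / m²`, which is summable. The clause `1 ≤ m`
  -- empties the event at `m = 0`, where the bound reads `0`.
  let s : ℕ → Set Ω := fun m => {ω | 1 ≤ m ∧ 2 * c * √(2 * Real.log m) / √(m : ℝ) ≤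
    ‖empGramian H (fun i : Fin m => ξ i ω) - gramian H μ‖}
  have hs : ∀ m, P (s m) ≤ ENNReal.ofReal (2 * (1 / (m : ℝ) ^ 2)) := by
    intro m
    rcases Nat.eq_zero_or_pos m with rfl | hm
    · simp [s]
    have hm' : (0 : ℝ) < m := by exact_mod_cast hm
    refine (measure_mono fun ω hω => hω.2).trans
      ((measure_norm_empGramian_sub_ge_le H hK hξ hlaw hind hc0 hc hm
        (mul_nonneg zero_le_two (Real.log_natCast_nonneg m))).trans (le_of_eq ?_))
    rw [Real.exp_neg, two_mul (Real.log m), Real.exp_add, Real.exp_log hm', one_div, pow_two]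
  have hsum : ∑' m, P (s m) ≠ ⊤ := by
    refine ne_top_of_le_ne_top ?_ (ENNReal.tsum_le_tsum hs)
    exact ((Real.summable_one_div_nat_pow.2 one_lt_two).mul_left 2).tsum_ofReal_ne_top
  filter_upwards [ae_eventually_notMem hsum] with ω hω
  filter_upwards [hω, eventually_ge_atTop 1] with m hm hm1
  by_contra hcon
  exact hm ⟨hm1, (not_le.1 hcon).le⟩

omit [IsProbabilityMeasure P] in
/-- Almost surely, `ker W_c ≤ ker W_{c,m}` for all `m`. -/
theorem ae_empGramian_apply_eq_zero (hK : Continuous fun p : X × X => kerR H p.1 p.2)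
    (hξ : ∀ i, Measurable (ξ i)) (hlaw : ∀ i, P.map (ξ i) = μ) :
    ∀ᵐ ω ∂P, ∀ n : H, gramian H μ n = 0 → ∀ m : ℕ,
      empGramian H (fun i : Fin m => ξ i ω) n = 0 := by
  -- A single null set, independent of `n`, serves the whole kernel and hence all `x` at once.
  have h : ∀ᵐ ω ∂P, ∀ i, ξ i ω ∈ μ.support := by
    refine ae_all_iff.2 fun i => ?_
    have h1 : ∀ᵐ x ∂(P.map (ξ i)), x ∈ μ.support := by
      rw [hlaw]; exact Measure.support_mem_ae
    exact ae_of_ae_map (hξ i).aemeasurable h1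
  filter_upwards [h] with ω hω n hn m
  exact empGramian_apply_eq_zero H fun i => apply_eq_zero_of_mem_support H μ hK hn (hω i)

theorem sample_error_le (hK : Continuous fun p : X × X => kerR H p.1 p.2)
    (hξ : ∀ i, Measurable (ξ i)) (hlaw : ∀ i, P.map (ξ i) = μ) (hind : iIndepFun ξ P)
    {r : ℝ} (hr : 0 < r) {m : ℕ} (hm : 1 ≤ m) {δ : ℝ} (hδ0 : 0 < δ) (hδ1 : δ ≤ 1) (x : X) :
    ENNReal.ofReal (1 - δ) ≤
      P {ω | |empEnergy H (fun i : Fin m => ξ i ω) r x - energy H μ r x| ≤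
        2 * √2 * kappa H ^ 4 * (r ^ 2 + kappa H ^ 4) / (r ^ 4 * √(m : ℝ)) *
          √(Real.log (2 / δ))} := by
  set G : Set Ω := {ω | |empEnergy H (fun i : Fin m => ξ i ω) r x - energy H μ r x| ≤
        2 * √2 * kappa H ^ 4 * (r ^ 2 + kappa H ^ 4) / (r ^ 4 * √(m : ℝ)) *
          √(Real.log (2 / δ))} with hG
  have hm' : (0 : ℝ) < m := by exact_mod_cast hm
  have hκ : 0 ≤ kappa H := kappa_nonneg H
  have hfx : ‖feat H x‖ ≤ kappa H := norm_feat_le H hK x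
  -- Subadditivity reduces the claim to the complement without measurability of `G`.
  suffices hbad : P Gᶜ ≤ ENNReal.ofReal δ by
    have h1 : (1 : ENNReal) ≤ P G + P Gᶜ := by
      rw [← measure_univ (μ := P), ← Set.union_compl_self G]
      exact measure_union_le _ _
    rw [ENNReal.ofReal_sub _ hδ0.le, ENNReal.ofReal_one]
    refine tsub_le_iff_right.2 (h1.trans ?_)
    gcongr
  -- The tail bound needs `c = 2 κ² > 0`; if `κ = 0`, all features and both energies vanish.
  rcases hκ.eq_or_lt with h0 | hκ0
  · have hf : feat H x = 0 := norm_le_zero_iff.1 (by rwa [← h0] at hfx)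
    have : G = Set.univ := by
      refine Set.eq_univ_of_forall fun ω => ?_
      simp only [hG, Set.mem_ofPred_eq, empEnergy, energy, regEnergy_eq, hf, inner_zero_right,
        mul_zero, sub_zero, abs_zero]
      positivity
    rw [this]
    simp
  have hL : 0 ≤ Real.log (2 / δ) := Real.log_nonneg (by rw [le_div_iff₀ hδ0]; linarith)
  have h := measure_norm_empGramian_sub_ge_le H hK hξ hlaw hind
    (c := 2 * kappa H ^ 2) (by positivity) le_rfl hm hL
  have e : 2 * Real.exp (-Real.log (2 / δ)) = δ := by
    rw [Real.exp_neg, Real.exp_log (by positivity)]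
    field_simp
  rw [e] at h
  refine (measure_mono fun ω hω => ?_).trans h
  by_contra hlt
  refine hω ?_
  have hε : ‖empGramian H (fun i : Fin m => ξ i ω) - gramian H μ‖ ≤
      2 * (2 * kappa H ^ 2) * √(Real.log (2 / δ)) / √(m : ℝ) :=
    (lt_of_not_ge hlt).le
  refine (abs_regEnergy_sub_le (empGramian_isPositive H _) (gramian_isPositive H μ hK) hr
    (norm_empGramian_le H hK hm _) (norm_gramian_le H μ hK) hε (feat H x)).trans ?_
  have h2 : (1 : ℝ) ≤ √2 := Real.one_le_sqrt.2 one_le_two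
  have hsm : 0 < √(m : ℝ) := Real.sqrt_pos.2 hm'
  calc _ ≤ 1 / 2 * (((kappa H ^ 2) ^ 2 + r ^ 2) / r ^ 4 *
        (2 * (2 * kappa H ^ 2) * √(Real.log (2 / δ)) / √(m : ℝ)) * kappa H ^ 2) := by gcongr
    _ = 1 * (2 * kappa H ^ 4 * (r ^ 2 + kappa H ^ 4) / (r ^ 4 * √(m : ℝ)) *
          √(Real.log (2 / δ))) := by
        field_simp
        ring
    -- The argument yields the constant `2`; the stated `2√2` leaves room.
    _ ≤ √2 * (2 * kappa H ^ 4 * (r ^ 2 + kappa H ^ 4) / (r ^ 4 * √(m : ℝ)) *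
          √(Real.log (2 / δ))) := by gcongr
    _ = _ := by ring

theorem ae_tendsto_empEnergy (hK : Continuous fun p : X × X => kerR H p.1 p.2)
    (hξ : ∀ i, Measurable (ξ i)) (hlaw : ∀ i, P.map (ξ i) = μ) (hind : iIndepFun ξ P)
    (hdom : ∀ x : X, InPinvDomain (gramian H μ) (feat H x)) {r : ℕ → ℝ}
    (hr : ∀ m, 1 ≤ m → 0 < r m) (hr0 : Tendsto r atTop (𝓝 0))
    (hrate : Tendsto (fun m : ℕ => √(Real.log m) / (r m * √(m : ℝ))) atTop (𝓝 0)) :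
    ∀ᵐ ω ∂P, ∀ x : X, Tendsto (fun m : ℕ => empEnergy H (fun i : Fin m => ξ i ω) (r m) x)
      atTop (𝓝 (pinvEnergy (gramian H μ) (feat H x) (hdom x))) := by
  have hW := gramian_isPositive H μ hK
  filter_upwards [ae_empGramian_apply_eq_zero H hK hξ hlaw,
    ae_eventually_norm_empGramian_sub_le H hK hξ hlaw hind
      -- The added `1` keeps `c` positive even when `κ = 0`; constants do not affect the limit.
      (c := 2 * kappa H ^ 2 + 1) (by positivity) (by linarith)] with ω hker hnorm x
  set c := 2 * kappa H ^ 2 + 1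
  obtain ⟨-, hn⟩ := apply_sub_pinvProj hW (feat H x) (hdom x)
  set g := pinvProj (gramian H μ) (feat H x) (hdom x)
  set n := feat H x - gramian H μ g with hndef
  have hx : feat H x = gramian H μ g + n := by rw [hndef]; abel
  have hr1 : Tendsto r atTop (𝓝[>] 0) := by
    refine tendsto_nhdsWithin_iff.2 ⟨hr0, ?_⟩
    filter_upwards [eventually_ge_atTop 1] with m hm using hr m hm
  have h1 := (tendsto_regEnergy hW (feat H x) (hdom x)).comp hr1
  have h2 : Tendsto (fun m : ℕ => 2 * c * √2 * (‖g‖ * ‖gramian H μ g‖) *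
      (√(Real.log m) / (r m * √(m : ℝ)))) atTop (𝓝 0) := by
    simpa using hrate.const_mul (2 * c * √2 * (‖g‖ * ‖gramian H μ g‖))
  have h3 : Tendsto (fun m : ℕ => empEnergy H (fun i : Fin m => ξ i ω) (r m) x -
      regEnergy (gramian H μ) (r m) (feat H x)) atTop (𝓝 0) := by
    refine squeeze_zero_norm' ?_ h2
    filter_upwards [hnorm, eventually_ge_atTop 1] with m hm hm1
    have hA := empGramian_isPositive H (fun i : Fin m => ξ i ω)
    -- Both operators annihilate `n`, so the energies are compared on `W g` alone.
    rw [empEnergy, hx, regEnergy_add_ker hA (hr m hm1) _ n (hker n hn m),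
      regEnergy_add_ker hW (hr m hm1) _ n hn, Real.norm_eq_abs]
    refine (abs_regEnergy_sub_apply_le hA hW (hr m hm1) hm g).trans (le_of_eq ?_)
    have := hr m hm1
    rw [Real.sqrt_mul zero_le_two]
    field_simp
  have h4 := h3.add h1
  rw [zero_add] at h4
  exact h4.congr fun m => by simp

end GramianConcentration

end

theorem mainTheorem1
    {n : ℕ} (X : Set (EuclideanSpace ℝ (Fin n))) (hX : IsCompact X)
    (H : Type*) [NormedAddCommGroup H] [InnerProductSpace ℝ H] [CompleteSpace H]
    [RKHS ℝ H X ℝ]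
    (hK : LocallyLipschitz (fun p : X × X => kerR H p.1 p.2))
    (μ : Measure X) [IsProbabilityMeasure μ]
    {Ω : Type*} [MeasurableSpace Ω] (P : Measure Ω) [IsProbabilityMeasure P]
    (ξ : ℕ → Ω → X) (hξ : ∀ i, Measurable (ξ i)) (hlaw : ∀ i, P.map (ξ i) = μ)
    (hind : iIndepFun ξ P) :
    -- sample error
    (∀ r : ℝ, 0 < r → ∀ m : ℕ, 1 ≤ m → ∀ δ : ℝ, 0 < δ → δ ≤ 1 → ∀ x : X,
      ENNReal.ofReal (1 - δ) ≤
        P {ω | |empEnergy H (fun i : Fin m => ξ i ω) r x - energy H μ r x| ≤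
          2 * √2 * kappa H ^ 4 * (r ^ 2 + kappa H ^ 4) / (r ^ 4 * √(m : ℝ)) *
            √(Real.log (2 / δ))}) ∧
    -- approximation error and almost sure convergence
    (∀ hdom : ∀ x : X, InPinvDomain (gramian H μ) (feat H x),
      BddAbove (Set.range fun x : X => ‖pinvProj (gramian H μ) (feat H x) (hdom x)‖) →
      (∀ x : X, Tendsto
        (fun r : ℝ => |energy H μ r x - pinvEnergy (gramian H μ) (feat H x) (hdom x)|)
        (𝓝[>] 0) (𝓝 0)) ∧
      (∀ r : ℕ → ℝ, (∀ m, 1 ≤ m → 0 < r m) → Tendsto r atTop (𝓝 0) →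
        Tendsto (fun m : ℕ => √(Real.log m) / (r m * √(m : ℝ))) atTop (𝓝 0) →
        ∀ᵐ ω ∂P, ∀ x : X, Tendsto
          (fun m : ℕ => |empEnergy H (fun i : Fin m => ξ i ω) (r m) x -
            pinvEnergy (gramian H μ) (feat H x) (hdom x)|)
          atTop (𝓝 0))) := by
  have : CompactSpace X := isCompact_iff_compactSpace.1 hX
  have hKc : Continuous fun p : X × X => kerR H p.1 p.2 := hK.continuous
  refine ⟨fun r hr m hm δ hδ0 hδ1 x => sample_error_le H hKc hξ hlaw hind hr hm hδ0 hδ1 x,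
    fun hdom _ => ⟨fun x => ?_, fun r hr hr0 hrate => ?_⟩⟩
  · simpa [energy] using
      (tendsto_iff_norm_sub_tendsto_zero.1
        (tendsto_regEnergy (gramian_isPositive H μ hKc) (feat H x) (hdom x)))
  · filter_upwards [ae_tendsto_empEnergy H hKc hξ hlaw hind hdom hr hr0 hrate] with ω hω x
    exact tendsto_iff_norm_sub_tendsto_zero.1 (hω x)
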